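/- All graphs are finite, simple and undirected. A biclique of a graph $G$ is a maximal induced complete bipartite subgraph of $G$ with both sides nonempty. The edge-biclique graph $KB_e(G)$ has the bicliques of $G$ as vertices, two distinct bicliques being adjacent if and only if they share an edge. Put $KB_e^0(G)=G$ and $KB_e^k(G)=KB_e^{k-1}(KB_e(G))$ for $k\ge 1$; $G$ diverges under $KB_e$ if $\lim_{k\to\infty}|V(KB_e^k(G))|=\infty$. For $n\ge 3$ and $m\ge 1$, the $(n,m)$-necklace is the graph on $n+m$ vertices consisting of an induced cycle $C_n$ and a complete graph $K_m$ such that, for one fixed edge $e$ of $C_n$, every vertex of $K_m$ is adjacent to both endpoints of $e$ and to no other vertex of $C_n$. An induced cycle $C=v_0v_1\dots v_{n-1}$, $n\ge 5$, of $G$ has good neighbours if for every $v\in V(G)\setminus C$ and every $i$ (indices modulo $n$), whenever $v$ is adjacent to $v_{i-1}$ and $v_{i+1}$, it is also adjacent to $v_i$. Let $n\ge 5$ and $m\ge 1$, and let $G$ be a graph that contains an induced $(n,m)$-necklace whose cycle has good neighbours in $G$. Then: (1) there is an $m'>m$ such that $KB_e^2(G)$ or $KB_e^3(G)$ contains an induced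 $(n,m')$-necklace whose cycle has good neighbours in that graph; (2) $G$ diverges under $KB_e$. -/

import Mathlib

universe u

namespace EdgeBiclique

/-- The vertex set `S` induces a complete bipartite subgraph of `G`, both sides being nonempty:
`S = U ∪ W` with `U`, `W` disjoint, nonempty, edgeless, and completely joined to each other. -/
def IsCompleteBipartiteOn {V : Type u} (G : SimpleGraph V) (S : Set V) : Prop :=
  ∃ U W : Set V, U.Nonempty ∧ W.Nonempty ∧ Disjoint U W ∧ U ∪ W = S ∧
    G.IsIndepSet U ∧ G.IsIndepSet W ∧ ∀ x ∈ U, ∀ y ∈ W, G.Adj x y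

/-- A biclique of `G`: a maximal induced complete bipartite subgraph. An induced subgraph is
identified with its vertex set. -/
def IsBiclique {V : Type u} (G : SimpleGraph V) (S : Set V) : Prop :=
  Maximal (IsCompleteBipartiteOn G) S

/-- The edge-biclique graph `KB_e(G)`: its vertices are the bicliques of `G`, and two distinct
bicliques are adjacent when they have a common edge. (Bicliques are induced subgraphs, so an edge
of `G` is an edge of a biclique exactly when both its endpoints lie in it.) -/
def edgeBicliqueGraph {V : Type u} (G : SimpleGraph V) :
    SimpleGraph {S : Set V // IsBiclique G S} where
  Adj A B := A ≠ B ∧ ∃ x y : V, G.Adj x y ∧ x ∈ A.1 ∧ y ∈ A.1 ∧ x ∈ B.1 ∧ y ∈ B.1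
  symm := ⟨fun _ _ ⟨hne, x, y, h, hxA, hyA, hxB, hyB⟩ =>
    ⟨hne.symm, x, y, h, hxB, hyB, hxA, hyA⟩⟩
  loopless := ⟨fun _ h => h.1 rfl⟩

/-- A graph together with its vertex type, so that graph operators can be iterated. -/
structure Graph where
  /-- the vertex type -/
  V : Type u
  /-- the graph on it -/
  graph : SimpleGraph V

/-- The operator `KB_e` on graphs. -/
def KBe (H : Graph.{u}) : Graph.{u} :=
  ⟨{S : Set H.V // IsBiclique H.graph S}, edgeBicliqueGraph H.graph⟩

/-- The finite graph `H` diverges under the operator `F`: the number of vertices of `F^k(H)`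
tends to infinity with `k`. -/
def Diverges (F : Graph.{u} → Graph.{u}) (H : Graph.{u}) : Prop :=
  Filter.Tendsto (fun k : ℕ => Nat.card (F^[k] H).V) Filter.atTop Filter.atTop

/-- The `(n, m)`-necklace (for `n ≥ 3`): the cycle `C_n` on `ZMod n`, with `i` adjacent to `i + 1`,
and the complete graph `K_m` on `Fin m`, every vertex of `K_m` being adjacent to the two endpoints
of the edge `{0, 1}` of the cycle and to no other vertex of it. -/
def necklace (n m : ℕ) : SimpleGraph (ZMod n ⊕ Fin m) where
  Adj x y :=
    match x, y with
    | Sum.inl i, Sum.inl j => (SimpleGraph.circulantGraph ({1} : Set (ZMod n))).Adj i j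
    | Sum.inr a, Sum.inr b => a ≠ b
    | Sum.inl i, Sum.inr _ => i = 0 ∨ i = 1
    | Sum.inr _, Sum.inl j => j = 0 ∨ j = 1
  symm := ⟨by
    rintro (i | a) (j | b) h
    · exact SimpleGraph.Adj.symm h
    · exact h
    · exact h
    · exact Ne.symm h⟩
  loopless := ⟨by
    rintro (i | a) h
    · exact SimpleGraph.irrefl _ h
    · exact h rfl⟩

/-- The cycle `c 0, c 1, …, c (n - 1)` of `G` (indices modulo `n`) has good neighbours: every
vertex outside the cycle adjacent to `c (i - 1)` and `c (i + 1)` is adjacent to `c i`. -/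
def GoodNeighbors {V : Type u} (G : SimpleGraph V) {n : ℕ} (c : ZMod n → V) : Prop :=
  ∀ v : V, v ∉ Set.range c → ∀ i : ZMod n,
    G.Adj v (c (i - 1)) → G.Adj v (c (i + 1)) → G.Adj v (c i)

/-- `G` contains an induced `(n, m)`-necklace whose cycle has good neighbours in `G`. -/
def HasGoodNecklace {V : Type u} (G : SimpleGraph V) (n m : ℕ) : Prop :=
  ∃ f : necklace n m ↪g G, GoodNeighbors G (fun i : ZMod n => f (Sum.inl i))

end EdgeBiclique

/-! The good-neighbour condition makes every biclique through a path `c (i - 1), c i, c (i + 1)` of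
the cycle a star centred at `c i`. Two such stars share an edge exactly when their centres are
consecutive, so they form an induced cycle of the same length, again with good neighbours
(`IsGoodCycle.edgeBiclique`).

A clique vertex `w` attached to a cycle edge spans an induced path with one end of that edge and the
next cycle vertex beyond it. A biclique through this path is attached to the adjacent edge of the
new cycle, and different `w` give different, pairwise adjacent bicliques. Hence `KB_e` preserves a
good necklace and can shift its clique one edge either way.

Growth comes from shifting both ways. After one step the clique consists of bicliques `A k`; the
second step sends it backwards to `R k` and forwards to `Q k`; the third brings both families back
to one common edge. No `R k` is adjacent to a `Q l` (`not_adj_second_level`), so no biclique through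
the common edge can contain both. The two returning families are therefore disjoint and together
form a larger clique. -/

namespace EdgeBiclique

/-! ### Two-colourings of bicliques -/

section Bicliques

variable {V : Type u} {G : SimpleGraph V}

/-- A set inducing a complete bipartite subgraph carries a two-colouring whose bichromatic pairs
are exactly the adjacent ones. -/
theorem IsCompleteBipartiteOn.exists_coloring {S : Set V} (h : IsCompleteBipartiteOn G S) :
    ∃ s : V → Prop, ∀ x ∈ S, ∀ y ∈ S, (G.Adj x y ↔ ¬(s x ↔ s y)) := by
  obtain ⟨U, W, -, -, hd, rfl, hU, hW, hUW⟩ := h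
  refine ⟨fun x => x ∈ U, fun x hx y hy => ?_⟩
  have key : ∀ z ∈ W, z ∉ U := fun z hz hz' => Set.disjoint_left.1 hd hz' hz
  have ind : ∀ {T : Set V}, G.IsIndepSet T → ∀ a ∈ T, ∀ b ∈ T, ¬ G.Adj a b :=
    fun hT a ha b hb hab => hT ha hb hab.ne hab
  rcases hx with hx | hx <;> rcases hy with hy | hy
  · simp [hx, hy, ind hU x hx y hy]
  · simp [hx, key y hy, hUW x hx y hy]
  · simp [hy, key x hx, (hUW y hy x hx).symm]
  · simp [key x hx, key y hy, ind hW x hx y hy]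

theorem isCompleteBipartiteOn_path {x y z : V} (hxy : G.Adj x y) (hyz : G.Adj y z)
    (hxz : ¬ G.Adj x z) : IsCompleteBipartiteOn G {x, y, z} := by
  refine ⟨{y}, {x, z}, by simp, by simp, ?_, ?_, ?_, ?_, ?_⟩
  · simp [hxy.ne', hyz.ne]
  · ext t; simp; tauto
  · simp [SimpleGraph.IsIndepSet]
  · have hzx : ¬ G.Adj z x := fun h => hxz h.symm
    intro a ha b hb _
    rcases ha with rfl | rfl <;> rcases hb with rfl | rfl <;> simp [hxz, hzx]
  · simp [hxy.symm, hyz]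

/-- In a finite graph every induced path on three vertices lies in a biclique. -/
theorem exists_biclique [Finite V] {x y z : V} (hxy : G.Adj x y) (hyz : G.Adj y z)
    (hxz : ¬ G.Adj x z) :
    ∃ B : {S : Set V // IsBiclique G S}, x ∈ B.1 ∧ y ∈ B.1 ∧ z ∈ B.1 := by
  obtain ⟨S, hS, hmax⟩ := Finite.exists_le_maximal (isCompleteBipartiteOn_path hxy hyz hxz)
  exact ⟨⟨S, hmax⟩, hS (by simp), hS (by simp), hS (by simp)⟩

theorem biclique_coloring (B : {S : Set V // IsBiclique G S}) :
    ∃ s : V → Prop, ∀ x ∈ B.1, ∀ y ∈ B.1, (G.Adj x y ↔ ¬(s x ↔ s y)) :=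
  B.2.1.exists_coloring

theorem biclique_triangle_free (B : {S : Set V // IsBiclique G S}) {x y z : V} (hx : x ∈ B.1)
    (hy : y ∈ B.1) (hz : z ∈ B.1) (hxy : G.Adj x y) (hyz : G.Adj y z) (hxz : G.Adj x z) :
    False := by
  obtain ⟨s, hs⟩ := biclique_coloring B
  have h1 := (hs x hx y hy).1 hxy
  have h2 := (hs y hy z hz).1 hyz
  have h3 := (hs x hx z hz).1 hxz
  tauto

/-- In a biclique the ends of a walk of length three are adjacent. -/
theorem biclique_adj_of_walk (B : {S : Set V // IsBiclique G S}) {x y z t : V} (hx : x ∈ B.1)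
    (hy : y ∈ B.1) (hz : z ∈ B.1) (ht : t ∈ B.1) (hxy : G.Adj x y) (hyz : G.Adj y z)
    (hzt : G.Adj z t) : G.Adj x t := by
  obtain ⟨s, hs⟩ := biclique_coloring B
  have h1 := (hs x hx y hy).1 hxy
  have h2 := (hs y hy z hz).1 hyz
  have h3 := (hs z hz t ht).1 hzt
  rw [hs x hx t ht]
  tauto

theorem biclique_adj_or (B : {S : Set V // IsBiclique G S}) {x y z : V} (hx : x ∈ B.1)
    (hy : y ∈ B.1) (hz : z ∈ B.1) (hxy : G.Adj x y) : G.Adj z x ∨ G.Adj z y := by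
  obtain ⟨s, hs⟩ := biclique_coloring B
  have h1 := (hs x hx y hy).1 hxy
  rw [hs z hz x hx, hs z hz y hy]
  tauto

end Bicliques

theorem zmod_natCast_ne_zero {n k : ℕ} (hk : k ≠ 0) (h : k < n) : (k : ZMod n) ≠ 0 := by
  rw [Ne, ZMod.natCast_eq_zero_iff]
  exact Nat.not_dvd_of_pos_of_lt (Nat.pos_of_ne_zero hk) h

/-- `c` parametrizes an induced cycle with good neighbours. -/
structure IsGoodCycle {V : Type u} (G : SimpleGraph V) {n : ℕ} (c : ZMod n → V) : Prop where
  five_le : 5 ≤ n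
  inj : Function.Injective c
  adj : ∀ i j, G.Adj (c i) (c j) ↔ j = i + 1 ∨ i = j + 1
  good : GoodNeighbors G c

/-- `w` lies outside the cycle `c` and its neighbours on the cycle are `c i` and `c (i + 1)`. -/
def IsAttached {V : Type u} (G : SimpleGraph V) {n : ℕ} (c : ZMod n → V) (i : ZMod n) (w : V) :
    Prop :=
  w ∉ Set.range c ∧ ∀ j, G.Adj w (c j) ↔ j = i ∨ j = i + 1

/-- The bicliques `b i` extend the paths `c (i - 1), c i, c (i + 1)`. -/
def ExtendsPaths {V : Type u} (G : SimpleGraph V) {n : ℕ} (c : ZMod n → V)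
    (b : ZMod n → {S : Set V // IsBiclique G S}) : Prop :=
  ∀ i, c (i - 1) ∈ (b i).1 ∧ c i ∈ (b i).1 ∧ c (i + 1) ∈ (b i).1

/-! ### Good cycles and their stars -/

section Cycle

variable {V : Type u} {G : SimpleGraph V} {n : ℕ} {c : ZMod n → V}
  {b : ZMod n → {S : Set V // IsBiclique G S}}

namespace IsGoodCycle

theorem small_ne_zero (hc : IsGoodCycle G c) :
    (1 : ZMod n) ≠ 0 ∧ (2 : ZMod n) ≠ 0 ∧ (3 : ZMod n) ≠ 0 ∧ (4 : ZMod n) ≠ 0 := by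
  have h5 := hc.five_le
  have h1 := zmod_natCast_ne_zero (n := n) (k := 1) (by omega) (by omega)
  have h2 := zmod_natCast_ne_zero (n := n) (k := 2) (by omega) (by omega)
  have h3 := zmod_natCast_ne_zero (n := n) (k := 3) (by omega) (by omega)
  have h4 := zmod_natCast_ne_zero (n := n) (k := 4) (by omega) (by omega)
  push_cast at h1 h2 h3 h4
  exact ⟨h1, h2, h3, h4⟩

theorem adj_succ (hc : IsGoodCycle G c) (i : ZMod n) : G.Adj (c i) (c (i + 1)) :=
  (hc.adj _ _).2 (Or.inl rfl)

theorem adj_pred (hc : IsGoodCycle G c) (i : ZMod n) : G.Adj (c (i - 1)) (c i) :=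
  (hc.adj _ _).2 (Or.inl (by ring))

theorem not_adj_two (hc : IsGoodCycle G c) (i : ZMod n) : ¬ G.Adj (c (i - 1)) (c (i + 1)) := by
  obtain ⟨h1, -, h3, -⟩ := hc.small_ne_zero
  rw [hc.adj]
  rintro (h | h)
  · exact h1 (by linear_combination h)
  · exact h3 (by linear_combination -h)

theorem not_adj_three (hc : IsGoodCycle G c) (i : ZMod n) :
    ¬ G.Adj (c (i - 1)) (c (i + 2)) := by
  obtain ⟨-, h2, -, h4⟩ := hc.small_ne_zero
  rw [hc.adj]
  rintro (h | h)
  · exact h2 (by linear_combination h)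
  · exact h4 (by linear_combination -h)

/-- Extends the good-neighbour condition to vertices of the cycle itself: as `n ≥ 5`, two cycle
vertices at distance two have a single common neighbour on the cycle. -/
theorem eq_or_adj (hc : IsGoodCycle G c) {v : V} {i : ZMod n} (h₁ : G.Adj v (c (i - 1)))
    (h₂ : G.Adj v (c (i + 1))) : v = c i ∨ G.Adj v (c i) := by
  by_cases hv : v ∈ Set.range c
  · obtain ⟨j, rfl⟩ := hv
    left
    obtain ⟨h1, h2, h3, h4⟩ := hc.small_ne_zero
    rw [hc.adj] at h₁ h₂
    have : j = i := by grind
    rw [this]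
  · exact Or.inr (hc.good v hv i h₁ h₂)

theorem eq_or_adj' (hc : IsGoodCycle G c) {v : V} {i : ZMod n} (h₁ : G.Adj v (c i))
    (h₂ : G.Adj v (c (i + 2))) : v = c (i + 1) ∨ G.Adj v (c (i + 1)) :=
  hc.eq_or_adj (by rwa [add_sub_cancel_right]) (by rwa [add_assoc, one_add_one_eq_two])

theorem exists_extendsPaths [Finite V] (hc : IsGoodCycle G c) :
    ∃ b : ZMod n → {S : Set V // IsBiclique G S}, ExtendsPaths G c b := by
  choose b hb using fun i => exists_biclique (hc.adj_pred i) (hc.adj_succ i) (hc.not_adj_two i)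
  exact ⟨b, hb⟩

/-- A biclique extending a path of the cycle is a star centred at the middle vertex. -/
theorem eq_or_adj_of_mem (hc : IsGoodCycle G c) (hb : ExtendsPaths G c b) {i : ZMod n} {x : V}
    (hx : x ∈ (b i).1) : x = c i ∨ G.Adj x (c i) := by
  obtain ⟨m₁, m₂, m₃⟩ := hb i
  by_contra! h
  have h₁ := (biclique_adj_or (b i) m₁ m₂ hx (hc.adj_pred i)).resolve_right h.2
  have h₂ := (biclique_adj_or (b i) m₂ m₃ hx (hc.adj_succ i)).resolve_left h.2
  rcases hc.eq_or_adj h₁ h₂ with h' | h'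
  · exact h.1 h'
  · exact h.2 h'

theorem center_mem_edge (hc : IsGoodCycle G c) (hb : ExtendsPaths G c b) {i : ZMod n} {x y : V}
    (hx : x ∈ (b i).1) (hy : y ∈ (b i).1) (hxy : G.Adj x y) : x = c i ∨ y = c i := by
  rcases hc.eq_or_adj_of_mem hb hx with h | h
  · exact Or.inl h
  rcases hc.eq_or_adj_of_mem hb hy with h' | h'
  · exact Or.inr h'
  · exact (biclique_triangle_free (b i) hx hy (hb i).2.1 hxy h' h).elim

/-- Every edge of the star `b i` passes through its centre, so adjacency to `b i` forces membership
of `c i`. -/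
theorem exists_edge_of_adj (hc : IsGoodCycle G c) (hb : ExtendsPaths G c b) {i : ZMod n}
    {X : {S : Set V // IsBiclique G S}} (h : (edgeBicliqueGraph G).Adj X (b i)) :
    c i ∈ X.1 ∧ ∃ y, G.Adj (c i) y ∧ y ∈ X.1 ∧ y ∈ (b i).1 := by
  obtain ⟨-, x, y, hxy, hx, hy, hx', hy'⟩ := h
  rcases hc.center_mem_edge hb hx' hy' hxy with rfl | rfl
  · exact ⟨hx, y, hxy, hy, hy'⟩
  · exact ⟨hy, x, hxy.symm, hx, hx'⟩

theorem succ_mem (hb : ExtendsPaths G c b) (i : ZMod n) : c i ∈ (b (i + 1)).1 := by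
  simpa using (hb (i + 1)).1

theorem center_eq (hc : IsGoodCycle G c) (hb : ExtendsPaths G c b) {i j : ZMod n}
    (hi : c (i - 1) ∈ (b j).1) (hi' : c i ∈ (b j).1) (hi'' : c (i + 1) ∈ (b j).1) : i = j := by
  have h2 := hc.small_ne_zero.2.1
  have e₁ := hc.center_mem_edge hb hi hi' (hc.adj_pred i)
  have e₂ := hc.center_mem_edge hb hi' hi'' (hc.adj_succ i)
  simp only [hc.inj.eq_iff] at e₁ e₂
  rcases e₁ with e₁ | rfl
  · rcases e₂ with rfl | e₂
    · rfl
    · exact (h2 (by linear_combination e₂ - e₁)).elim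
  · rfl

/-- The stars extending the paths of a good cycle form a good cycle of the edge-biclique graph. -/
theorem edgeBiclique (hc : IsGoodCycle G c) (hb : ExtendsPaths G c b) :
    IsGoodCycle (edgeBicliqueGraph G) b := by
  have hinj : Function.Injective b := fun i j hij => by
    obtain ⟨m₁, m₂, m₃⟩ := hb i
    rw [hij] at m₁ m₂ m₃
    exact hc.center_eq hb m₁ m₂ m₃
  have hsucc : ∀ i, (edgeBicliqueGraph G).Adj (b i) (b (i + 1)) := fun i =>
    ⟨fun h => hc.small_ne_zero.1 (by simpa using hinj h), c i, c (i + 1), hc.adj_succ i,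
      (hb i).2.1, (hb i).2.2, succ_mem hb i, (hb (i + 1)).2.1⟩
  refine ⟨hc.five_le, hinj, fun i j => ⟨fun h => ?_, ?_⟩, fun X hX i h₁ h₂ => ?_⟩
  · have hm := (hc.exists_edge_of_adj hb h.symm).1
    rw [← hc.adj]
    rcases hc.eq_or_adj_of_mem hb hm with h' | h'
    · exact (h.ne (congrArg b (hc.inj h'))).elim
    · exact h'
  · rintro (rfl | rfl)
    · exact hsucc i
    · exact (hsucc j).symm
  · obtain ⟨hp, x, hx, hxX, hxb⟩ := hc.exists_edge_of_adj hb h₁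
    obtain ⟨hq, -⟩ := hc.exists_edge_of_adj hb h₂
    -- `x` is a common neighbour of `c (i - 1)` and `c (i + 1)`. It must be `c i`, since otherwise
    -- `c (i - 1), x, c i` is a triangle in `b (i - 1)`.
    have hxq : G.Adj x (c (i + 1)) :=
      (biclique_adj_or X hp hxX hq hx).elim
        (fun h => (hc.not_adj_two i h.symm).elim) (fun h => h.symm)
    have hmem : c i ∈ (b (i - 1)).1 := by simpa using (hb (i - 1)).2.2
    rcases hc.eq_or_adj hx.symm hxq with rfl | hxi
    · exact ⟨fun h => hX ⟨i, h.symm⟩, c (i - 1), c i, hx, hp, hxX, (hb i).1, (hb i).2.1⟩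
    · exact (biclique_triangle_free (b (i - 1)) (hb (i - 1)).2.1 hxb hmem hx hxi
        (hc.adj_pred i)).elim

/-- A biclique through exactly one edge of the cycle is attached to the corresponding edge of the
cycle of stars. -/
theorem isAttached_of_mem (hc : IsGoodCycle G c) (hb : ExtendsPaths G c b) {i : ZMod n}
    {T : {S : Set V // IsBiclique G S}} (h₀ : c i ∈ T.1) (h₁ : c (i + 1) ∈ T.1)
    (hl : c (i - 1) ∉ T.1) (hr : c (i + 2) ∉ T.1) :
    IsAttached (edgeBicliqueGraph G) b i T := by
  have hmem : ∀ j, c j ∈ T.1 → j = i ∨ j = i + 1 := by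
    intro j hj
    by_contra! hne
    rcases biclique_adj_or T h₀ h₁ hj (hc.adj_succ i) with h | h <;> rw [hc.adj] at h
    · have : j = i - 1 := by grind
      exact hl (this ▸ hj)
    · have : j = i + 2 := by grind
      exact hr (this ▸ hj)
  have hnot : T ∉ Set.range b := by
    rintro ⟨j, rfl⟩
    obtain ⟨h1, h2, h3, h4⟩ := hc.small_ne_zero
    obtain ⟨m₁, m₂, m₃⟩ := hb j
    have := hmem _ m₁
    have := hmem _ m₃
    grind
  refine ⟨hnot, fun j => ⟨fun h => hmem j (hc.exists_edge_of_adj hb h).1, fun h => ?_⟩⟩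
  refine ⟨fun h' => hnot ⟨j, h'.symm⟩, c i, c (i + 1), hc.adj_succ i, h₀, h₁, ?_⟩
  rcases h with rfl | rfl
  · exact (hb j).2
  · exact ⟨succ_mem hb i, (hb _).2.1⟩

/-- `T` cannot contain `c (i - 1)`, as a walk of length three would make it adjacent to `w`, nor `c
(i + 2)`, which forms a triangle with `w` and `c (i + 1)`. -/
theorem isAttached_pred (hc : IsGoodCycle G c) (hb : ExtendsPaths G c b) {i : ZMod n} {w : V}
    (hw : IsAttached G c (i + 1) w) {T : {S : Set V // IsBiclique G S}} (hwT : w ∈ T.1)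
    (h₀ : c i ∈ T.1) (h₁ : c (i + 1) ∈ T.1) : IsAttached (edgeBicliqueGraph G) b i T := by
  obtain ⟨-, h2, h3, -⟩ := hc.small_ne_zero
  have hw₁ : G.Adj w (c (i + 1)) := (hw.2 _).2 (Or.inl rfl)
  have hw₂ : G.Adj w (c (i + 2)) := (hw.2 _).2 (by grind)
  have a₀ : G.Adj (c (i - 1)) (c i) := hc.adj_pred i
  have a₁ : G.Adj (c i) (c (i + 1)) := hc.adj_succ i
  have a₂ : G.Adj (c (i + 1)) (c (i + 2)) := (hc.adj _ _).2 (by grind)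
  refine hc.isAttached_of_mem hb h₀ h₁ (fun h => ?_) fun h => ?_
  · rcases (hw.2 _).1 (biclique_adj_of_walk T h h₀ h₁ hwT a₀ a₁ hw₁.symm).symm with h | h
    · exact h2 (by linear_combination -h)
    · exact h3 (by linear_combination -h)
  · exact biclique_triangle_free T hwT h₁ h hw₁ a₂ hw₂

theorem isAttached_succ (hc : IsGoodCycle G c) (hb : ExtendsPaths G c b) {i : ZMod n} {w : V}
    (hw : IsAttached G c (i - 1) w) {T : {S : Set V // IsBiclique G S}} (hwT : w ∈ T.1)
    (h₀ : c i ∈ T.1) (h₁ : c (i + 1) ∈ T.1) : IsAttached (edgeBicliqueGraph G) b i T := by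
  obtain ⟨-, h2, h3, -⟩ := hc.small_ne_zero
  have hw₁ : G.Adj w (c (i - 1)) := (hw.2 _).2 (Or.inl rfl)
  have hw₂ : G.Adj w (c i) := (hw.2 _).2 (by grind)
  have a₀ : G.Adj (c (i - 1)) (c i) := hc.adj_pred i
  have a₁ : G.Adj (c i) (c (i + 1)) := hc.adj_succ i
  have a₂ : G.Adj (c (i + 1)) (c (i + 2)) := (hc.adj _ _).2 (by grind)
  refine hc.isAttached_of_mem hb h₀ h₁ (fun h => ?_) fun h => ?_
  · exact biclique_triangle_free T hwT h h₀ hw₁ a₀ hw₂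
  · rcases (hw.2 _).1 (biclique_adj_of_walk T hwT h₀ h₁ h hw₂ a₁ a₂) with h | h
    · exact h3 (by linear_combination h)
    · exact h2 (by linear_combination h)

/-- Distinct vertices of a clique attached to an edge, extended along the cycle to one side, lie
in distinct adjacent bicliques. -/
theorem adj_of_adj (hc : IsGoodCycle G c) {i k : ZMod n} {w w' : V}
    (hk : G.Adj w (c k)) (hk' : G.Adj w' (c k)) (hki : k = i ∨ k = i + 1) (hww : G.Adj w w')
    {T T' : {S : Set V // IsBiclique G S}} (hwT : w ∈ T.1) (hwT' : w' ∈ T'.1)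
    (h₀ : c i ∈ T.1) (h₁ : c (i + 1) ∈ T.1) (h₀' : c i ∈ T'.1) (h₁' : c (i + 1) ∈ T'.1) :
    (edgeBicliqueGraph G).Adj T T' := by
  refine ⟨?_, c i, c (i + 1), hc.adj_succ i, h₀, h₁, h₀', h₁'⟩
  rintro rfl
  rcases hki with rfl | rfl
  · exact biclique_triangle_free T hwT hwT' h₀ hww hk' hk
  · exact biclique_triangle_free T hwT hwT' h₁ hww hk' hk

/-- Vertices attached to two edges of the cycle at distance one, extended to the edge between
them, lie in distinct adjacent bicliques as soon as they are not adjacent. -/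
theorem adj_of_not_adj (hc : IsGoodCycle G c) {i : ZMod n} {w w' : V}
    (hk : G.Adj w (c i)) (hk' : G.Adj w' (c (i + 1))) (hww : ¬ G.Adj w w')
    {T T' : {S : Set V // IsBiclique G S}} (hwT : w ∈ T.1) (hwT' : w' ∈ T'.1)
    (h₀ : c i ∈ T.1) (h₁ : c (i + 1) ∈ T.1) (h₀' : c i ∈ T'.1) (h₁' : c (i + 1) ∈ T'.1) :
    (edgeBicliqueGraph G).Adj T T' := by
  refine ⟨?_, c i, c (i + 1), hc.adj_succ i, h₀, h₁, h₀', h₁'⟩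
  rintro rfl
  exact hww (biclique_adj_of_walk T hwT h₀ h₁ hwT' hk (hc.adj_succ i) hk'.symm)

/-- No biclique meets both a biclique through the edge `c i, c (i + 1)` and the stars at the two
cycle vertices next to this edge. -/
theorem not_adj_of_adj_stars (hc : IsGoodCycle G c) (hb : ExtendsPaths G c b) {i : ZMod n}
    {A X : {S : Set V // IsBiclique G S}} (h₀ : c i ∈ A.1) (h₁ : c (i + 1) ∈ A.1)
    (hX : (edgeBicliqueGraph G).Adj X (b (i - 1))) (hX' : (edgeBicliqueGraph G).Adj X (b (i + 2))) :
    ¬ (edgeBicliqueGraph G).Adj X A := by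
  obtain ⟨hl, -⟩ := hc.exists_edge_of_adj hb hX
  obtain ⟨hr, -⟩ := hc.exists_edge_of_adj hb hX'
  have hlr := hc.not_adj_three i
  have a₀ : G.Adj (c (i - 1)) (c i) := hc.adj_pred i
  have a₁ : G.Adj (c i) (c (i + 1)) := hc.adj_succ i
  have a₂ : G.Adj (c (i + 1)) (c (i + 2)) := (hc.adj _ _).2 (by grind)
  obtain ⟨s, hs⟩ := biclique_coloring A
  obtain ⟨t, ht⟩ := biclique_coloring X
  -- Here `p` is the end of the shared edge on the side of `c (i + 1)` in `A`. In `X` the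
  -- nonadjacent `c (i - 1)` and `c (i + 2)` lie on one side, so `p` or `q` is adjacent to both,
  -- against good neighbours at `c (i + 1)` or `c i`.
  have hmain : ∀ p q, G.Adj p q → p ∈ X.1 → q ∈ X.1 → p ∈ A.1 → q ∈ A.1 →
      (s p ↔ s (c (i + 1))) → False := by
    intro p q hpq hpX hqX hpA hqA hp
    have e₀ := (hs _ h₀ _ h₁).1 a₁
    have e₁ := (hs _ hpA _ hqA).1 hpq
    have f₀ := (ht _ hpX _ hqX).1 hpq
    have f₁ := mt (ht _ hl _ hr).2 hlr
    have p₀ : G.Adj p (c i) := (hs _ hpA _ h₀).2 (by clear * - e₀ hp; tauto)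
    have p₁ : ¬ G.Adj p (c (i + 1)) := mt (hs _ hpA _ h₁).1 (not_not.2 hp)
    have q₀ : ¬ G.Adj q (c i) := mt (hs _ hqA _ h₀).1 (by clear * - e₀ e₁ hp; tauto)
    have q₁ : G.Adj q (c (i + 1)) := (hs _ hqA _ h₁).2 (by clear * - e₁ hp; tauto)
    by_cases hpl : (t p ↔ t (c (i - 1)))
    · have ql : G.Adj q (c (i - 1)) := (ht _ hqX _ hl).2 (by clear * - f₀ hpl; tauto)
      have qr : G.Adj q (c (i + 2)) := (ht _ hqX _ hr).2 (by clear * - f₀ f₁ hpl; tauto)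
      rcases hc.eq_or_adj ql q₁ with rfl | h
      · have h' := (hc.adj _ _).1 qr
        obtain ⟨h1, -, h3, -⟩ := hc.small_ne_zero
        rcases h' with h' | h'
        · exact h1 (by linear_combination h')
        · exact h3 (by linear_combination -h')
      · exact q₀ h
    · have pl : G.Adj p (c (i - 1)) := (ht _ hpX _ hl).2 hpl
      have pr : G.Adj p (c (i + 2)) := (ht _ hpX _ hr).2 (by clear * - f₁ hpl; tauto)
      rcases hc.eq_or_adj' p₀ pr with rfl | h
      · have h' := (hc.adj _ _).1 pl
        obtain ⟨h1, -, h3, -⟩ := hc.small_ne_zero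
        rcases h' with h' | h'
        · exact h3 (by linear_combination -h')
        · exact h1 (by linear_combination h')
      · exact p₁ h
  rintro ⟨-, p, q, hpq, hpX, hqX, hpA, hqA⟩
  have e := (hs _ hpA _ hqA).1 hpq
  by_cases hp : s p ↔ s (c (i + 1))
  · exact hmain p q hpq hpX hqX hpA hqA hp
  · exact hmain q p hpq.symm hqX hpX hqA hpA (by clear * - e hp; tauto)

/-- Second-level bicliques extending an attached biclique away from an edge of the cycle of stars
do not meet those through the next edge on the other side. -/
theorem not_adj_second_level (hc : IsGoodCycle G c) (hb : ExtendsPaths G c b) {i : ZMod n}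
    {A : {S : Set V // IsBiclique G S}} (h₀ : c i ∈ A.1) (h₁ : c (i + 1) ∈ A.1)
    (hA : IsAttached (edgeBicliqueGraph G) b i A)
    {R Q : {S : Set {S : Set V // IsBiclique G S} // IsBiclique (edgeBicliqueGraph G) S}}
    (hAR : A ∈ R.1) (hR₀ : b i ∈ R.1) (hR₁ : b (i - 1) ∈ R.1)
    (hQ₀ : b (i + 1) ∈ Q.1) (hQ₁ : b (i + 2) ∈ Q.1) :
    ¬ (edgeBicliqueGraph (edgeBicliqueGraph G)).Adj R Q := by
  have hB := hc.edgeBiclique hb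
  have a₀ := hB.adj_pred i
  have a₂ : (edgeBicliqueGraph G).Adj (b (i + 1)) (b (i + 2)) := (hB.adj _ _).2 (by grind)
  have hA₀ : (edgeBicliqueGraph G).Adj A (b i) := (hA.2 _).2 (Or.inl rfl)
  have hA₁ : (edgeBicliqueGraph G).Adj A (b (i + 1)) := (hA.2 _).2 (Or.inr rfl)
  obtain ⟨s, hs⟩ := biclique_coloring R
  obtain ⟨t, ht⟩ := biclique_coloring Q
  have hmain : ∀ X Y, (edgeBicliqueGraph G).Adj X Y → X ∈ R.1 → Y ∈ R.1 → X ∈ Q.1 → Y ∈ Q.1 →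
      (s X ↔ s (b i)) → False := by
    intro X Y hXY hXR hYR hXQ hYQ hX
    have e₀ := (hs _ hR₁ _ hR₀).1 a₀
    have e₁ := (hs _ hXR _ hYR).1 hXY
    have e₂ := (hs _ hAR _ hR₀).1 hA₀
    have f₀ := (ht _ hXQ _ hYQ).1 hXY
    have f₁ := (ht _ hQ₀ _ hQ₁).1 a₂
    have x₀ : (edgeBicliqueGraph G).Adj X (b (i - 1)) := (hs _ hXR _ hR₁).2 (by clear * - e₀ hX; tauto)
    have x₁ : (edgeBicliqueGraph G).Adj X A := (hs _ hXR _ hAR).2 (by clear * - e₂ hX; tauto)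
    have x₂ : ¬ (edgeBicliqueGraph G).Adj X (b i) := mt (hs _ hXR _ hR₀).1 (not_not.2 hX)
    have y₀ : (edgeBicliqueGraph G).Adj Y (b i) := (hs _ hYR _ hR₀).2 (by clear * - e₁ hX; tauto)
    have y₁ : ¬ (edgeBicliqueGraph G).Adj A Y := mt (hs _ hAR _ hYR).1 (by clear * - e₁ e₂ hX; tauto)
    -- Either `X` meets `A` and both outer stars, or `Y` is adjacent to `b i` and `b (i + 2)` but
    -- not to `b (i + 1)`. Good neighbours then give `Y = b (i + 1)`, which is adjacent to `A`.
    by_cases hXt : (t X ↔ t (b (i + 1)))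
    · exact hc.not_adj_of_adj_stars hb h₀ h₁ x₀ ((ht _ hXQ _ hQ₁).2 (by clear * - f₁ hXt; tauto)) x₁
    · have y₂ : (edgeBicliqueGraph G).Adj Y (b (i + 2)) := (ht _ hYQ _ hQ₁).2 (by clear * - f₀ f₁ hXt; tauto)
      have y₃ : ¬ (edgeBicliqueGraph G).Adj Y (b (i + 1)) := mt (ht _ hYQ _ hQ₀).1 (by clear * - f₀ hXt; tauto)
      rcases hB.eq_or_adj' y₀ y₂ with rfl | h
      · exact y₁ hA₁
      · exact y₃ h
  rintro ⟨-, X, Y, hXY, hXR, hYR, hXQ, hYQ⟩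
  have e := (hs _ hXR _ hYR).1 hXY
  by_cases hX : s X ↔ s (b i)
  · exact hmain X Y hXY hXR hYR hXQ hYQ hX
  · exact hmain Y X hXY.symm hYR hXR hYQ hXQ (by clear * - e hX; tauto)

end IsGoodCycle

end Cycle

/-! ### Necklaces at an arbitrary edge of the cycle -/

/-- A good cycle with a clique, indexed by `ι`, attached to its edge `c i, c (i + 1)`. -/
structure IsGoodNecklaceAt {V : Type u} (G : SimpleGraph V) {n : ℕ} {ι : Type*} (c : ZMod n → V)
    (i : ZMod n) (w : ι → V) : Prop where
  cycle : IsGoodCycle G c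
  attached : ∀ k, IsAttached G c i (w k)
  clique : ∀ k l, k ≠ l → G.Adj (w k) (w l)

theorem HasGoodNecklace.exists_isGoodNecklaceAt {V : Type u} {G : SimpleGraph V} {n m : ℕ}
    (hn : 5 ≤ n) (h : HasGoodNecklace G n m) :
    ∃ (c : ZMod n → V) (w : Fin m → V), IsGoodNecklaceAt G c 0 w := by
  obtain ⟨f, hf⟩ := h
  have h1 := zmod_natCast_ne_zero (n := n) (k := 1) (by omega) (by omega)
  push_cast at h1
  refine ⟨fun i => f (Sum.inl i), fun k => f (Sum.inr k),
    ⟨hn, fun i j hij => Sum.inl_injective (f.injective hij), fun i j => ?_, hf⟩,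
    fun k => ⟨?_, fun j => ?_⟩, fun k l hkl => ?_⟩
  · rw [f.map_adj_iff]
    change (SimpleGraph.circulantGraph ({1} : Set (ZMod n))).Adj i j ↔ _
    simp only [SimpleGraph.circulantGraph_adj, Set.mem_singleton_iff]
    grind
  · rintro ⟨j, hj⟩
    exact Sum.inl_ne_inr (f.injective hj)
  · rw [f.map_adj_iff, zero_add]
    exact Iff.rfl
  · rw [f.map_adj_iff]
    exact hkl

theorem IsGoodNecklaceAt.hasGoodNecklace {V : Type u} {G : SimpleGraph V} {n m : ℕ}
    {c : ZMod n → V} {i : ZMod n} {w : Fin m → V} (h : IsGoodNecklaceAt G c i w) :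
    HasGoodNecklace G n m := by
  have h1 := h.cycle.small_ne_zero.1
  refine ⟨⟨⟨Sum.elim (fun j => c (i + j)) w, ?_⟩, ?_⟩, ?_⟩
  · rintro (j | k) (j' | k') hjk
    · simpa using h.cycle.inj hjk
    · exact ((h.attached k').1 ⟨_, hjk⟩).elim
    · exact ((h.attached k).1 ⟨_, hjk.symm⟩).elim
    · by_contra hne
      exact (h.clique k k' (fun e => hne (congrArg _ e))).ne hjk
  · rintro (j | k) (j' | k')
    · change G.Adj (c (i + j)) (c (i + j')) ↔
        (SimpleGraph.circulantGraph ({1} : Set (ZMod n))).Adj j j'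
      rw [h.cycle.adj]
      simp only [SimpleGraph.circulantGraph_adj, Set.mem_singleton_iff]
      grind
    · change G.Adj (c (i + j)) (w k') ↔ j = 0 ∨ j = 1
      rw [G.adj_comm, (h.attached k').2]
      simp
    · change G.Adj (w k) (c (i + j')) ↔ j' = 0 ∨ j' = 1
      rw [(h.attached k).2]
      simp
    · change G.Adj (w k) (w k') ↔ k ≠ k'
      exact ⟨fun hk e => hk.ne (congrArg w e), h.clique k k'⟩
  · intro v hv j h₁ h₂
    refine h.cycle.good v ?_ (i + j) ?_ ?_
    · rintro ⟨j', rfl⟩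
      exact hv ⟨j' - i, congrArg c (by ring)⟩
    · rw [add_sub_assoc]
      exact h₁
    · rw [add_assoc]
      exact h₂

/-! ### Shifting the clique, growth and divergence -/

section Step

variable {V : Type u} [Finite V] {G : SimpleGraph V} {n : ℕ} {ι : Type*} {c : ZMod n → V}
  {w : ι → V} {b : ZMod n → {S : Set V // IsBiclique G S}}

/-- Extending the clique of a necklace backwards along the cycle. -/
theorem IsGoodNecklaceAt.exists_pred {i : ZMod n} (h : IsGoodNecklaceAt G c (i + 1) w)
    (hb : ExtendsPaths G c b) :
    ∃ T : ι → {S : Set V // IsBiclique G S}, IsGoodNecklaceAt (edgeBicliqueGraph G) b i T ∧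
      ∀ k, w k ∈ (T k).1 ∧ c i ∈ (T k).1 ∧ c (i + 1) ∈ (T k).1 := by
  obtain ⟨h1, h2, -, -⟩ := h.cycle.small_ne_zero
  have hw₁ : ∀ k, G.Adj (w k) (c (i + 1)) := fun k => ((h.attached k).2 _).2 (Or.inl rfl)
  have hw₀ : ∀ k, ¬ G.Adj (w k) (c i) := fun k hk => by
    rcases ((h.attached k).2 _).1 hk with h | h
    · exact h1 (by linear_combination -h)
    · exact h2 (by linear_combination -h)
  choose T hT using fun k => exists_biclique (hw₁ k) (h.cycle.adj_succ i).symm (hw₀ k)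
  refine ⟨T, ⟨h.cycle.edgeBiclique hb,
    fun k => h.cycle.isAttached_pred hb (h.attached k) (hT k).1 (hT k).2.2 (hT k).2.1,
    fun k l hkl => h.cycle.adj_of_adj (hw₁ k) (hw₁ l) (Or.inr rfl) (h.clique k l hkl) (hT k).1
      (hT l).1 (hT k).2.2 (hT k).2.1 (hT l).2.2 (hT l).2.1⟩,
    fun k => ⟨(hT k).1, (hT k).2.2, (hT k).2.1⟩⟩

/-- Extending the clique of a necklace forwards along the cycle. -/
theorem IsGoodNecklaceAt.exists_succ {i : ZMod n} (h : IsGoodNecklaceAt G c (i - 1) w)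
    (hb : ExtendsPaths G c b) :
    ∃ T : ι → {S : Set V // IsBiclique G S}, IsGoodNecklaceAt (edgeBicliqueGraph G) b i T ∧
      ∀ k, w k ∈ (T k).1 ∧ c i ∈ (T k).1 ∧ c (i + 1) ∈ (T k).1 := by
  obtain ⟨h1, h2, -, -⟩ := h.cycle.small_ne_zero
  have hw₁ : ∀ k, G.Adj (w k) (c i) := fun k => ((h.attached k).2 _).2 (Or.inr (by ring))
  have hw₀ : ∀ k, ¬ G.Adj (w k) (c (i + 1)) := fun k hk => by
    rcases ((h.attached k).2 _).1 hk with h | h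
    · exact h2 (by linear_combination h)
    · exact h1 (by linear_combination h)
  choose T hT using fun k => exists_biclique (hw₁ k) (h.cycle.adj_succ i) (hw₀ k)
  exact ⟨T, ⟨h.cycle.edgeBiclique hb,
    fun k => h.cycle.isAttached_succ hb (h.attached k) (hT k).1 (hT k).2.1 (hT k).2.2,
    fun k l hkl => h.cycle.adj_of_adj (hw₁ k) (hw₁ l) (Or.inl rfl) (h.clique k l hkl) (hT k).1
      (hT l).1 (hT k).2.1 (hT k).2.2 (hT l).2.1 (hT l).2.2⟩, hT⟩

end Step

theorem HasGoodNecklace.edgeBicliqueGraph {V : Type u} [Finite V] {G : SimpleGraph V} {n m : ℕ}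
    (hn : 5 ≤ n) (h : HasGoodNecklace G n m) :
    HasGoodNecklace (edgeBicliqueGraph G) n m := by
  obtain ⟨c, w, hw⟩ := h.exists_isGoodNecklaceAt hn
  obtain ⟨b, hb⟩ := hw.cycle.exists_extendsPaths
  obtain ⟨T, hT, -⟩ := IsGoodNecklaceAt.exists_pred (i := -1) (by simpa using hw) hb
  exact hT.hasGoodNecklace

/-- Three applications of the edge-biclique operator enlarge the clique of a good necklace. -/
theorem HasGoodNecklace.succ_edgeBicliqueGraph_three {V : Type u} [Finite V] {G : SimpleGraph V}
    {n m : ℕ} (hn : 5 ≤ n) (hm : 1 ≤ m) (h : HasGoodNecklace G n m) :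
    HasGoodNecklace (EdgeBiclique.edgeBicliqueGraph (EdgeBiclique.edgeBicliqueGraph
      (EdgeBiclique.edgeBicliqueGraph G))) n (m + 1) := by
  obtain ⟨c, w, hw⟩ := h.exists_isGoodNecklaceAt hn
  obtain ⟨b, hb⟩ := hw.cycle.exists_extendsPaths
  -- This step makes the clique consist of bicliques through one cycle edge, as the nonadjacency of
  -- `R` and `Q` requires.
  obtain ⟨A, hA, hAm⟩ := IsGoodNecklaceAt.exists_pred (i := -1) (by simpa using hw) hb
  obtain ⟨d, hd⟩ := hA.cycle.exists_extendsPaths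
  obtain ⟨R, hR, hRm⟩ := IsGoodNecklaceAt.exists_pred (i := -2)
    (by convert hA using 1; ring) hd
  obtain ⟨Q, hQ, hQm⟩ := IsGoodNecklaceAt.exists_succ (i := 0) (by simpa using hA) hd
  obtain ⟨e, he⟩ := hR.cycle.exists_extendsPaths
  obtain ⟨T, hT, hTm⟩ := IsGoodNecklaceAt.exists_succ (i := -1)
    (by convert hR using 1; ring) he
  obtain ⟨T', hT', hTm'⟩ := IsGoodNecklaceAt.exists_pred (i := -1) (by simpa using hQ) he
  have hRQ : ∀ k l, ¬ (EdgeBiclique.edgeBicliqueGraph (EdgeBiclique.edgeBicliqueGraph G)).Adj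
      (R k) (Q l) := fun k l => by
    have e₁ : (-2 : ZMod n) + 1 = -1 := by ring
    have e₂ : (-1 : ZMod n) - 1 = -2 := by ring
    have e₃ : (-1 : ZMod n) + 1 = 0 := by ring
    have e₄ : (-1 : ZMod n) + 2 = 0 + 1 := by ring
    refine hw.cycle.not_adj_second_level hb (i := -1) (A := A k) (hAm k).2.1 (hAm k).2.2
      (hA.attached k) (hRm k).1 (e₁ ▸ (hRm k).2.2) (e₂ ▸ (hRm k).2.1) (e₃ ▸ (hQm l).2.1)
      (e₄ ▸ (hQm l).2.2)
  have hTT : ∀ k l, (EdgeBiclique.edgeBicliqueGraph (EdgeBiclique.edgeBicliqueGraph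
      (EdgeBiclique.edgeBicliqueGraph G))).Adj (T k) (T' l) := fun k l =>
    hR.cycle.adj_of_not_adj (i := -1) (((hR.attached k).2 _).2 (Or.inr (by ring)))
      (((hQ.attached l).2 _).2 (Or.inl (by ring))) (hRQ k l) (hTm k).1 (hTm' l).1
      (hTm k).2.1 (hTm k).2.2 (hTm' l).2.1 (hTm' l).2.2
  -- All `T k` and `T' l` together would give a clique of size `2 * m`; one extra vertex is enough.
  refine IsGoodNecklaceAt.hasGoodNecklace (c := e) (i := -1)
    (w := Fin.cons (T' ⟨0, hm⟩) T) ⟨hT.cycle, ?_, ?_⟩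
  · intro k
    cases k using Fin.cases with
    | zero => exact hT'.attached _
    | succ k => exact hT.attached k
  · intro k l hkl
    cases k using Fin.cases with
    | zero =>
      cases l using Fin.cases with
      | zero => exact (hkl rfl).elim
      | succ l => exact (hTT l _).symm
    | succ k =>
      cases l using Fin.cases with
      | zero => exact hTT k _
      | succ l => exact hT.clique k l (fun h => hkl (congrArg _ h))

theorem HasGoodNecklace.le_card {V : Type u} [Finite V] {G : SimpleGraph V} {n m : ℕ}
    (h : HasGoodNecklace G n m) : m ≤ Nat.card V := by
  obtain ⟨f, -⟩ := h
  simpa using Nat.card_le_card_of_injective (fun k : Fin m => f (Sum.inr k))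
    (f.injective.comp Sum.inr_injective)

theorem finite_iterate_KBe (H : Graph.{u}) [Finite H.V] (k : ℕ) : Finite (KBe^[k] H).V := by
  induction k with
  | zero => assumption
  | succ k ih =>
    rw [Function.iterate_succ_apply']
    exact inferInstanceAs (Finite {S : Set (KBe^[k] H).V // IsBiclique (KBe^[k] H).graph S})

/-- Each block of three steps adds a clique vertex; the `r` remaining steps lose none. -/
theorem HasGoodNecklace.iterate {H : Graph.{u}} [Finite H.V] {n m : ℕ} (hn : 5 ≤ n) (hm : 1 ≤ m)
    (h : HasGoodNecklace H.graph n m) (q r : ℕ) :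
    HasGoodNecklace (KBe^[r + 3 * q] H).graph n (m + q) := by
  have hq : HasGoodNecklace (KBe^[3 * q] H).graph n (m + q) := by
    induction q with
    | zero => exact h
    | succ q ih =>
      have := finite_iterate_KBe H (3 * q)
      rw [show 3 * (q + 1) = 3 * q + 1 + 1 + 1 by ring, Function.iterate_succ_apply',
        Function.iterate_succ_apply', Function.iterate_succ_apply']
      have hmq : 1 ≤ m + q := le_add_right hm
      exact ih.succ_edgeBicliqueGraph_three hn hmq
  induction r with
  | zero => rwa [zero_add]
  | succ r ih =>
    have := finite_iterate_KBe H (r + 3 * q)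
    rw [add_right_comm, Function.iterate_succ_apply']
    exact ih.edgeBicliqueGraph hn

/-- A finite graph containing a good necklace diverges under `KB_e`. -/
theorem HasGoodNecklace.diverges {H : Graph.{u}} [Finite H.V] {n m : ℕ} (hn : 5 ≤ n) (hm : 1 ≤ m)
    (h : HasGoodNecklace H.graph n m) : Diverges KBe H := by
  refine Filter.tendsto_atTop_mono (fun k => ?_) (Nat.tendsto_div_const_atTop (show 3 ≠ 0 by simp))
  have := finite_iterate_KBe H k
  have hk := h.iterate hn hm (k / 3) (k % 3)
  rw [Nat.mod_add_div] at hk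
  exact le_trans (Nat.le_add_left _ _) hk.le_card

end EdgeBiclique

theorem mainTheorem2 {V : Type u} [Finite V] (G : SimpleGraph V) (n m : ℕ)
    (hn : 5 ≤ n) (hm : 1 ≤ m) (h : EdgeBiclique.HasGoodNecklace G n m) :
    (∃ m' : ℕ, m < m' ∧
      (EdgeBiclique.HasGoodNecklace (EdgeBiclique.KBe^[2] ⟨V, G⟩).graph n m' ∨
        EdgeBiclique.HasGoodNecklace (EdgeBiclique.KBe^[3] ⟨V, G⟩).graph n m')) ∧
    EdgeBiclique.Diverges EdgeBiclique.KBe ⟨V, G⟩ :=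
  ⟨⟨m + 1, Nat.lt_succ_self m, Or.inr (h.succ_edgeBicliqueGraph_three hn hm)⟩,
    EdgeBiclique.HasGoodNecklace.diverges (H := ⟨V, G⟩) hn hm h⟩
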